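/- Let $E$ be a Dedekind complete Riesz space with a weak order unit $e$. A conditional expectation operator on $E$ is a positive order continuous linear projection on $E$ whose range is a Dedekind complete Riesz subspace of $E$ and which maps weak order units to weak order units. Let $T$ be a conditional expectation operator on $E$ with $Te=e$ and range $R(T)$, and suppose that $E$ is $T$-universally complete, $E=L^1(T)$: every upwards directed net $(f_\alpha)$ in $E_+$ for which $(Tf_\alpha)$ is order bounded in the universal completion $E^u$ of $E$ is order convergent in $E$. Let $U$ and $V$ be conditional expectation operators on $E$ compatible with $T$, that is, $TU=T=UT$ and $TV=T=VT$. Write $\|f\|_{T,1}=T|f|$, and for $W\in\{U,V\}$ let $\mathcal B(W)$ be the set of band projections $P$ on $E$ with $Pe\in R(W)$. Let $$\alpha_T(U,V)=\sup\{\,|TPQe-TPe\cdot TQe| \;:\; P\in\mathcal B(U),\ Q\in\mathcal B(V)\,\},$$ where $\cdot$ is the multiplication of the $f$-algebra of $e$-bounded elements of $E$ with algebraic unit $e$. Then $$\alpha_T(U,V)\;\le\;\sup_{Q\in\mathcal B(V)}\|UQe-TQe\|_{T,1}\;\le\;2\,\alpha_T(U,V),$$ where both suprema are of subsets of $R(T)$,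 exist in $E$ and belong to $R(T)$ (so they are also the suprema in $R(T)$). -/

import Mathlib

namespace RieszCE

universe u v

/-! A Riesz space (vector lattice) is a real vector space with a lattice order compatible with the
linear structure: `[AddCommGroup E] [Lattice E] [IsOrderedAddMonoid E] [Module ℝ E]
[IsOrderedModule ℝ E]`.  It is Dedekind complete when the lattice is a
`ConditionallyCompleteLattice`. -/

section Basic

variable {E : Type u} [AddCommGroup E] [Lattice E]

/-- A weak order unit: a positive element `e` such that only `0` is disjoint from `e`. -/
def IsWeakOrderUnit (e : E) : Prop :=
  0 ≤ e ∧ ∀ x : E, e ⊓ |x| = 0 → x = 0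

/-- A universally complete Riesz space: Dedekind complete, and every (nonempty) set of mutually
disjoint positive elements has a supremum. -/
structure IsUniversallyComplete (F : Type u) [AddCommGroup F] [Lattice F] : Prop where
  dedekind : ∀ S : Set F, S.Nonempty → BddAbove S → ∃ a, IsLUB S a
  lateral : ∀ S : Set F, S.Nonempty → (∀ x ∈ S, 0 ≤ x) →
    (∀ x ∈ S, ∀ y ∈ S, x ≠ y → x ⊓ y = 0) → ∃ a, IsLUB S a

variable [Module ℝ E]

/-- `ι : E → F` exhibits `F` as a universal completion of `E`: `F` is universally complete and
`ι` identifies `E` with an order dense Riesz subspace of `F`. -/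
structure IsUniversalCompletion {F : Type v} [AddCommGroup F] [Lattice F] [Module ℝ F]
    (ι : E →ₗ[ℝ] F) : Prop where
  universallyComplete : IsUniversallyComplete F
  injective : Function.Injective ι
  map_sup : ∀ x y : E, ι (x ⊔ y) = ι x ⊔ ι y
  order_dense : ∀ y : F, 0 < y → ∃ x : E, 0 < ι x ∧ ι x ≤ y

/-- A conditional expectation operator: a positive order continuous linear projection `T` whose
range is a Dedekind complete Riesz subspace and which maps weak order units to weak order units.
Order continuity of the positive operator `T` means that `D ↓ 0` implies `T D ↓ 0`. -/
structure IsConditionalExpectation (T : E →ₗ[ℝ] E) : Prop where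
  nonneg : ∀ x : E, 0 ≤ x → 0 ≤ T x
  idem : ∀ x : E, T (T x) = T x
  order_continuous : ∀ D : Set E, D.Nonempty → DirectedOn (· ≥ ·) D → IsGLB D 0 →
    IsGLB (T '' D) 0
  range_sup : ∀ x ∈ LinearMap.range T, ∀ y ∈ LinearMap.range T, x ⊔ y ∈ LinearMap.range T
  range_dedekind : ∀ S : Set (LinearMap.range T), S.Nonempty → BddAbove S → ∃ a, IsLUB S a
  weakOrderUnit : ∀ w : E, IsWeakOrderUnit w → IsWeakOrderUnit (T w)

/-- `E` is `T`-universally complete, i.e. `E = L¹(T)`: every upwards directed family in `E₊` whose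
image under `T` is order bounded in the universal completion of `E` (given by `ι`) converges in
order in `E`.  For an upwards directed family, order convergence is the existence of the
supremum. -/
def IsTUniversallyComplete {F : Type v} [AddCommGroup F] [Lattice F] [Module ℝ F]
    (ι : E →ₗ[ℝ] F) (T : E →ₗ[ℝ] E) : Prop :=
  ∀ D : Set E, D.Nonempty → DirectedOn (· ≤ ·) D → (∀ f ∈ D, 0 ≤ f) →
    BddAbove ((fun f => ι (T f)) '' D) → ∃ a, IsLUB D a

/-- `U` is compatible with `T`: `TU = T = UT`. -/
def IsCompatible (U T : E →ₗ[ℝ] E) : Prop :=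
  T ∘ₗ U = T ∧ U ∘ₗ T = T

/-- A band projection: a linear projection `P` with `0 ≤ P ≤ I`. -/
structure IsBandProjection (P : E →ₗ[ℝ] E) : Prop where
  idem : ∀ x : E, P (P x) = P x
  nonneg : ∀ x : E, 0 ≤ x → 0 ≤ P x
  le_self : ∀ x : E, 0 ≤ x → P x ≤ x

/-- `𝓑(U)`: the band projections `P` with `P e ∈ R(U)`. -/
def bandProjections (e : E) (U : E →ₗ[ℝ] E) : Set (E →ₗ[ℝ] E) :=
  {P | IsBandProjection P ∧ P e ∈ LinearMap.range U}

/-- The `R(T)`-valued norm `‖f‖_{T,1} = T|f|`. -/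
def tNorm (T : E →ₗ[ℝ] E) (f : E) : E := T |f|

end Basic

/-- The formula behind the definition of the product below: in an Archimedean f-algebra with
unit `1`, the square of a bounded element `f` is the supremum of `2 t f - t² 1`, `t ∈ ℝ`
(the hypothesis `hf` is the defining property of an f-algebra). -/
theorem isLUB_mul_self {A : Type u} [CommRing A] [Lattice A] [IsOrderedRing A] [Algebra ℝ A]
    [IsOrderedModule ℝ A]
    (hf : ∀ a b c : A, a ⊓ b = 0 → 0 ≤ c → (c * a) ⊓ b = 0)
    (harch : ∀ a b : A, (∀ n : ℕ, n • a ≤ b) → a ≤ 0)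
    (f : A) (k : ℝ) (hk : |f| ≤ k • (1 : A)) :
    IsLUB (Set.range fun t : ℝ => (2 * t) • f - (t ^ 2) • (1 : A)) (f * f) := by
  have hmul0 : ∀ p q : A, 0 ≤ p → 0 ≤ q → p ⊓ q = 0 → p * q = 0 := by
    intro p q hp hq h
    have h1 := hf p q q h hq
    rw [inf_comm] at h1
    have h2 := hf q (q * p) p h1 hp
    rwa [mul_comm q p, inf_idem] at h2
  have hpn : ∀ x : A, x⁺ * x⁻ = 0 := fun x =>
    hmul0 _ _ (posPart_nonneg x) (negPart_nonneg x) (posPart_inf_negPart_eq_zero x)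
  have habs : ∀ x : A, |x| * |x| = x * x := by
    intro x
    have h1 := hpn x
    have h2 := posPart_sub_negPart x
    have h3 := posPart_add_negPart x
    rw [← h3]
    nth_rewrite 5 [← h2]
    nth_rewrite 7 [← h2]
    linear_combination 4 * h1
  have hsq : ∀ x : A, 0 ≤ x * x := by
    intro x
    rw [← habs]
    exact mul_nonneg (abs_nonneg x) (abs_nonneg x)
  have key : ∀ t : ℝ, f * f - ((2 * t) • f - (t ^ 2) • (1 : A)) =
      (f - t • (1 : A)) * (f - t • (1 : A)) := by
    intro t
    simp only [Algebra.smul_def, map_mul, map_pow, map_ofNat]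
    ring
  have h01 : (0 : A) ≤ 1 := zero_le_one
  have hone : ∀ r : ℝ, 0 ≤ r → (0 : A) ≤ r • (1 : A) := fun r hr => smul_nonneg hr h01
  refine ⟨?_, ?_⟩
  · rintro _ ⟨t, rfl⟩
    have := hsq (f - t • (1 : A))
    rw [← key] at this
    exact sub_nonneg.mp this
  intro h hh
  -- `w = (f² - h)⁺` lies below every `(f - t)²`
  have hw : ∀ t : ℝ, (f * f - h) ⊔ 0 ≤ (f - t • (1 : A)) * (f - t • (1 : A)) := by
    intro t
    refine sup_le ?_ (hsq _)
    rw [← key]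
    exact sub_le_sub_left (hh ⟨t, rfl⟩) _
  set w : A := (f * f - h) ⊔ 0 with hwdef
  have hat : ∀ x D : A, 0 ≤ D →
      ((x + D) ⊔ 0 - x ⊔ 0) - (x ⊔ 0 - (x - D) ⊔ 0) ≤ (D - |x|) ⊔ 0 := by
    intro x D hD
    have hx : |x| = x ⊔ 0 + x ⊔ 0 - x := by
      have h2 := posPart_sub_negPart x
      have h3 := posPart_add_negPart x
      rw [posPart_def] at h2 h3
      have h4 : x⁻ = x ⊔ 0 - x := eq_sub_of_add_eq' (sub_eq_iff_eq_add.1 h2).symm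
      rw [← h3, h4]
      abel
    have hp : x ≤ x ⊔ 0 := le_sup_left
    have hp0 : 0 ≤ x ⊔ 0 := le_sup_right
    have hg : D - |x| ≤ (D - |x|) ⊔ 0 := le_sup_left
    have hg0 : 0 ≤ (D - |x|) ⊔ 0 := le_sup_right
    rw [hx] at hg hg0 ⊢
    generalize hG : (D - (x ⊔ 0 + x ⊔ 0 - x)) ⊔ 0 = G at *
    generalize hP : x ⊔ 0 = p at *
    have e1 : (x + D) ⊔ 0 ≤ (G + p + p) - (x - D) ⊔ 0 := by
      have e2 : (x - D) ⊔ 0 ≤ (G + p + p) - (x + D) := by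
        refine sup_le ?_ ?_
        · have : 0 ≤ G + ((p - x) + (p - x)) :=
            add_nonneg hg0 (add_nonneg (sub_nonneg.2 hp) (sub_nonneg.2 hp))
          rw [← sub_nonneg]
          convert this using 1
          abel
        · rw [← sub_nonneg] at hg ⊢
          convert hg using 1
          abel
      have e3 : (x - D) ⊔ 0 ≤ (G + p + p) - 0 := by
        refine sup_le ?_ ?_
        · have : 0 ≤ G + p + (p - x) + D :=
            add_nonneg (add_nonneg (add_nonneg hg0 hp0) (sub_nonneg.2 hp)) hD
          rw [← sub_nonneg]
          convert this using 1
          abel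
        · simpa using add_nonneg (add_nonneg hg0 hp0) hp0
      exact sup_le (le_sub_comm.1 e2) (le_sub_comm.1 e3)
    rw [← sub_nonneg] at e1 ⊢
    convert e1 using 1
    abel
  -- `w ≤ δ²` for every `δ > 0`
  have hδ : ∀ δ : ℝ, 0 < δ → w ≤ (δ ^ 2) • (1 : A) := by
    intro δ hδ
    set D : A := δ • (1 : A) with hD
    have hD0 : 0 ≤ D := hone δ hδ.le
    set v : A := (w - (δ ^ 2) • (1 : A)) ⊔ 0 with hv
    have hv0 : 0 ≤ v := le_sup_right
    have hDD : D * D = (δ ^ 2) • (1 : A) := by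
      simp only [hD, Algebra.smul_def, map_pow]
      ring
    have disj : ∀ t : ℝ, v ⊓ ((D - |f - t • (1 : A)|) ⊔ 0) = 0 := by
      intro t
      set y : A := |f - t • (1 : A)| with hy
      have hy0 : 0 ≤ y := abs_nonneg _
      have hyD : 0 ≤ y + D := add_nonneg hy0 hD0
      have h1 : v ≤ (y + D) * (y - D)⁺ := by
        refine sup_le ?_ (mul_nonneg hyD (posPart_nonneg _))
        calc w - (δ ^ 2) • (1 : A) ≤ y * y - D * D := by
              rw [hDD, hy, habs]
              exact sub_le_sub_right (hw t) _
          _ = (y + D) * (y - D) := by ring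
          _ ≤ (y + D) * (y - D)⁺ := mul_le_mul_of_nonneg_left (le_posPart _) hyD
      have h2 := hf _ _ (y + D) (posPart_inf_negPart_eq_zero (y - D)) hyD
      rw [negPart_def, neg_sub] at h2
      refine le_antisymm ?_ (le_inf hv0 le_sup_right)
      exact (inf_le_inf_right _ h1).trans h2.le
    have infadd : ∀ a b : A, 0 ≤ a → 0 ≤ b → v ⊓ a = 0 → v ⊓ b = 0 → v ⊓ (a + b) = 0 := by
      intro a b ha hb h1 h2
      refine le_antisymm ?_ (le_inf hv0 (add_nonneg ha hb))
      have h3 : v ⊓ (a + b) - b ≤ v ⊓ a := by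
        refine le_inf ?_ ?_
        · exact (sub_le_self _ hb).trans inf_le_left
        · rw [sub_le_iff_le_add]
          exact inf_le_right
      rw [h1, sub_nonpos] at h3
      rw [← h2]
      exact le_inf inf_le_left h3
    -- telescoping sum of the hat functions
    have tel : ∀ n : ℕ, ∃ s : A, 0 ≤ s ∧ v ⊓ s = 0 ∧
        ((f + k • (1 : A) + D) ⊔ 0 - (f + k • (1 : A)) ⊔ 0)
          - ((f - (-k + (n : ℝ) * δ) • (1 : A) + D) ⊔ 0
              - (f - (-k + (n : ℝ) * δ) • (1 : A)) ⊔ 0) ≤ s := by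
      intro n
      induction n with
      | zero =>
        refine ⟨0, le_rfl, inf_eq_right.2 hv0, ?_⟩
        simp [sub_eq_add_neg]
      | succ n ih =>
        obtain ⟨s, hs, hvs, hle⟩ := ih
        refine ⟨s + (D - |f - (-k + (n : ℝ) * δ) • (1 : A)|) ⊔ 0,
          add_nonneg hs le_sup_right, infadd _ _ hs le_sup_right hvs (disj _), ?_⟩
        have h1 := add_le_add hle (hat (f - (-k + (n : ℝ) * δ) • (1 : A)) D hD0)
        have h2 : f - (-k + ((n + 1 : ℕ) : ℝ) * δ) • (1 : A)
            = f - (-k + (n : ℝ) * δ) • (1 : A) - D := by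
          rw [hD]
          push_cast
          module
        rw [h2, sub_add_cancel]
        refine le_trans (le_of_eq ?_) h1
        abel
    obtain ⟨n, hn⟩ := exists_nat_ge ((2 * k) / δ + 1)
    obtain ⟨s, hs, hvs, hle⟩ := tel n
    have hfk := abs_le'.1 hk
    have a1 : 0 ≤ f + k • (1 : A) := by
      have := hfk.2
      rwa [neg_le_iff_add_nonneg'] at this
    have a2 : f - (-k + (n : ℝ) * δ) • (1 : A) + D ≤ 0 := by
      have h3 : 0 ≤ (-k + (n : ℝ) * δ - δ - k) := by
        have h4 : ((2 * k) / δ + 1) * δ ≤ n * δ := mul_le_mul_of_nonneg_right hn hδ.le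
        have h5 : ((2 * k) / δ + 1) * δ = 2 * k + δ := by field_simp
        linarith
      have h6 := add_nonneg (hone _ h3) (sub_nonneg.2 hfk.1)
      rw [← neg_nonneg]
      refine h6.trans (le_of_eq ?_)
      rw [hD]
      module
    have a3 : f - (-k + (n : ℝ) * δ) • (1 : A) ≤ 0 := (le_add_of_nonneg_right hD0).trans a2
    rw [sup_eq_left.2 a1, sup_eq_left.2 (add_nonneg a1 hD0), sup_eq_right.2 a2,
      sup_eq_right.2 a3, sub_zero, sub_zero, add_sub_cancel_left] at hle
    have hvD : v ⊓ D = 0 := by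
      refine le_antisymm ?_ (le_inf hv0 hD0)
      rw [← hvs]
      exact inf_le_inf_left _ hle
    have hv2 : v ⊓ (δ • v) = 0 := by
      have h7 := hf D v v (by rw [inf_comm]; exact hvD) hv0
      rw [inf_comm] at h7
      convert h7 using 2
      rw [hD, mul_smul_comm, mul_one]
    have hmin : (min 1 δ) • v ≤ v ⊓ (δ • v) := by
      refine le_inf ?_ (smul_le_smul_of_nonneg_right (min_le_right _ _) hv0)
      conv_rhs => rw [← one_smul ℝ v]
      exact smul_le_smul_of_nonneg_right (min_le_left _ _) hv0
    rw [hv2] at hmin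
    have hmp : 0 < min 1 δ := lt_min one_pos hδ
    have hv00 : v ≤ 0 := by
      have := smul_le_smul_of_nonneg_left hmin (inv_nonneg.2 hmp.le)
      rwa [smul_smul, inv_mul_cancel₀ hmp.ne', one_smul, smul_zero] at this
    exact sub_nonpos.1 (le_sup_left.trans hv00)
  have hw0 : w ≤ 0 := by
    refine harch w 1 fun n => ?_
    rcases Nat.eq_zero_or_pos n with rfl | hn
    · simp
    have hn' : (0 : ℝ) < n := by exact_mod_cast hn
    have h1 := hδ (Real.sqrt (1 / n)) (Real.sqrt_pos.2 (by positivity))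
    rw [Real.sq_sqrt (by positivity)] at h1
    have h2 := smul_le_smul_of_nonneg_left h1 hn'.le
    rw [smul_smul, mul_one_div_cancel hn'.ne', one_smul] at h2
    rwa [Nat.cast_smul_eq_nsmul] at h2
  exact sub_nonpos.1 (le_sup_left.trans hw0)

section Product

variable {E : Type u} [AddCommGroup E] [ConditionallyCompleteLattice E] [Module ℝ E]

/-- The square of an `e`-bounded element in the f-algebra of `e`-bounded elements of a Dedekind
complete Riesz space, whose algebraic unit is `e`: `f² = sup_t (2 t f - t² e)`. -/
noncomputable def eSquare (e f : E) : E :=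
  sSup (Set.range fun t : ℝ => (2 * t) • f - (t ^ 2) • e)

/-- The product of two `e`-bounded elements in the f-algebra with algebraic unit `e`, obtained
from the squares by polarization. -/
noncomputable def eMul (e f g : E) : E :=
  (1 / 4 : ℝ) • (eSquare e (f + g) - eSquare e (f - g))

/-- The set `{|TPQe - TPe · TQe| : P ∈ 𝓑(U), Q ∈ 𝓑(V)}`. -/
def strongMixingSet (e : E) (T U V : E →ₗ[ℝ] E) : Set E :=
  {x | ∃ P ∈ bandProjections e U, ∃ Q ∈ bandProjections e V,
    x = |T (P (Q e)) - eMul e (T (P e)) (T (Q e))|}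

/-- The `T`-conditional strong mixing coefficient `α_T(U, V)`. -/
noncomputable def strongMixing (e : E) (T U V : E →ₗ[ℝ] E) : E :=
  sSup (strongMixingSet e T U V)

/-- The set `{‖UQe - TQe‖_{T,1} : Q ∈ 𝓑(V)}`. -/
def normDistanceSet (e : E) (T U V : E →ₗ[ℝ] E) : Set E :=
  {x | ∃ Q ∈ bandProjections e V, x = tNorm T (U (Q e) - T (Q e))}

end Product

end RieszCE

open RieszCE

namespace RieszCE

universe u

/-! ### Disjointness in lattice-ordered groups -/

section Lattice

variable {E : Type u} [AddCommGroup E] [Lattice E] [IsOrderedAddMonoid E]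

/-! Put `g = UQe - TQe`, an element of `R(U)`. Everything rests on `TPQe - TPe · TQe = TPg` for `P ∈
𝓑(U)` (`sub_eMul_eq`): `U` commutes with `P` and `TU = T`, so `TPQe = TPUQe`, while averaging gives
`TPe · TQe = TP(TQe)`. The left inequality is then `|TPg| ≤ T|g|`. For the right one, let `P`
project onto the band of `g⁺`. It belongs to `𝓑(U)` because `R(U)` is closed under suprema, by order
continuity, and `T|g| = TPg - T(I - P)g` is bounded by two members of the strong mixing set.

The laborious point is averaging, `T(Pf) = T(Pe) · f`, since the product is defined by suprema and
polarization. The unit is cut into bands, with projections in `𝓑(T)`, on which `f` and `T(Pe)` are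
constant up to `1/n` (`nonpos_of_locally_nonpos`). On each band both sides equal the product of the
two constants up to `O(1/n)`, and the Archimedean property finishes. -/

theorem inf_add_le_inf_add_inf {x a b : E} (hx : 0 ≤ x) (ha : 0 ≤ a) (hb : 0 ≤ b) :
    x ⊓ (a + b) ≤ x ⊓ a + x ⊓ b := by
  have h1 : x ⊓ (a + b) - x ⊓ b ≤ x ⊓ a := by
    rw [sub_le_iff_le_add]
    rw [inf_add, add_inf, add_inf]
    refine le_inf (le_inf ?_ ?_) (le_inf ?_ inf_le_right)
    · exact inf_le_left.trans (le_add_of_nonneg_left hx)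
    · exact inf_le_left.trans (le_add_of_nonneg_right hb)
    · exact inf_le_left.trans (le_add_of_nonneg_left ha)
  exact sub_le_iff_le_add.1 h1

theorem inf_nsmul_eq_zero {x g : E} (hx : 0 ≤ x) (hg : 0 ≤ g) (h : x ⊓ g = 0) (n : ℕ) :
    x ⊓ n • g = 0 := by
  induction n with
  | zero => simpa using hx
  | succ n ih =>
    refine le_antisymm ?_ (le_inf hx (nsmul_nonneg hg _))
    have := inf_add_le_inf_add_inf hx (nsmul_nonneg hg n) hg
    rwa [ih, h, add_zero, ← succ_nsmul] at this

end Lattice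

/-! ### Band projections: commutation and suprema -/

section BandProjection

variable {E : Type u} [AddCommGroup E] [Lattice E] [IsOrderedAddMonoid E] [Module ℝ E]

namespace IsBandProjection

variable {P Q : E →ₗ[ℝ] E}

theorem mono (hP : IsBandProjection P) {x y : E} (h : x ≤ y) : P x ≤ P y := by
  have := hP.nonneg (y - x) (sub_nonneg.2 h)
  rwa [map_sub, sub_nonneg] at this

theorem compl (hP : IsBandProjection P) : IsBandProjection (LinearMap.id - P) where
  idem x := by simp [hP.idem]
  nonneg x hx := by simpa using hP.le_self x hx
  le_self x hx := by simpa using hP.nonneg x hx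

/-- Since `0 ≤ QPx ≤ Px` and `I - P` is positive and kills `Px`, it kills `QPx` too. -/
theorem apply_comp_eq (hP : IsBandProjection P) (hQ : IsBandProjection Q) {x : E}
    (hx : 0 ≤ x) : Q (P x) = P (Q (P x)) := by
  have h1 : (LinearMap.id - P : E →ₗ[ℝ] E) (Q (P x)) ≤ (LinearMap.id - P : E →ₗ[ℝ] E) (P x) :=
    hP.compl.mono (hQ.le_self _ (hP.nonneg x hx))
  have h2 := hP.compl.nonneg _ (hQ.nonneg _ (hP.nonneg x hx))
  simp only [LinearMap.sub_apply, LinearMap.id_apply, hP.idem, sub_self] at h1 h2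
  exact sub_eq_zero.1 (le_antisymm h1 h2)

theorem comm (hP : IsBandProjection P) (hQ : IsBandProjection Q) (x : E) :
    P (Q x) = Q (P x) := by
  have key : ∀ y : E, 0 ≤ y → P (Q y) = Q (P y) := by
    intro y hy
    -- `Q` preserves the images of both `P` and `I - P`, hence commutes with `P`.
    have h1 := hP.apply_comp_eq hQ hy
    have h2 := hP.compl.apply_comp_eq hQ hy
    simp only [LinearMap.sub_apply, LinearMap.id_apply, map_sub] at h2
    have h3 : P (Q y) - P (Q (P y)) = 0 := by
      rw [← sub_eq_zero] at h2
      rw [← h2]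
      abel
    rw [sub_eq_zero.1 h3, ← h1]
  rw [← posPart_sub_negPart x]
  simp only [map_sub, key _ (posPart_nonneg x), key _ (negPart_nonneg x)]

theorem comp (hP : IsBandProjection P) (hQ : IsBandProjection Q) :
    IsBandProjection (P ∘ₗ Q) where
  idem x := by simp only [LinearMap.comp_apply]; rw [← hP.comm hQ, hQ.idem, hP.idem]
  nonneg x hx := hP.nonneg _ (hQ.nonneg x hx)
  le_self x hx := (hP.le_self _ (hQ.nonneg x hx)).trans (hQ.le_self x hx)

theorem isLUB_image (hP : IsBandProjection P) {S : Set E} {a : E} (h : IsLUB S a) :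
    IsLUB (P '' S) (P a) := by
  refine ⟨?_, fun b hb => ?_⟩
  · rintro _ ⟨s, hs, rfl⟩
    exact hP.mono (h.1 hs)
  -- A bound `b` of `P '' S` becomes a bound of `S` once `(I - P) a` is added.
  have h1 : a ≤ b + (LinearMap.id - P : E →ₗ[ℝ] E) a := by
    refine h.2 fun s hs => ?_
    have h2 := add_le_add (hb ⟨s, hs, rfl⟩) (hP.compl.mono (h.1 hs))
    simpa using h2
  have h3 : b + (LinearMap.id - P : E →ₗ[ℝ] E) a = a + (b - P a) := by
    simp only [LinearMap.sub_apply, LinearMap.id_apply]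
    abel
  rw [h3, le_add_iff_nonneg_right, sub_nonneg] at h1
  exact h1

end IsBandProjection

end BandProjection

/-! ### Principal band projections -/

section Principal

variable {E : Type u} [AddCommGroup E] [ConditionallyCompleteLattice E]

/-- The component of `x ≥ 0` in the band generated by `g ≥ 0`. -/
noncomputable def principalPart (g x : E) : E := sSup (Set.range fun n : ℕ => x ⊓ n • g)

theorem isLUB_principalPart (g x : E) :
    IsLUB (Set.range fun n : ℕ => x ⊓ n • g) (principalPart g x) :=
  isLUB_csSup (Set.range_nonempty _) ⟨x, by rintro _ ⟨n, rfl⟩; exact inf_le_left⟩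

theorem principalPart_nonneg {g x : E} (hx : 0 ≤ x) : 0 ≤ principalPart g x :=
  (isLUB_principalPart g x).1 ⟨0, by simpa using hx⟩

theorem principalPart_zero (g : E) : principalPart g 0 = 0 :=
  le_antisymm ((isLUB_principalPart g 0).2 (by rintro _ ⟨n, rfl⟩; exact inf_le_left))
    (principalPart_nonneg le_rfl)

variable [IsOrderedAddMonoid E]

/-- Archimedean property: the supremum `s` of the multiples of `x` satisfies `s ≤ s - x`. -/
theorem nonpos_of_nsmul_le {x b : E} (h : ∀ n : ℕ, n • x ≤ b) : x ≤ 0 := by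
  have hl := isLUB_csSup (Set.range_nonempty fun n : ℕ => n • x)
    ⟨b, by rintro _ ⟨n, rfl⟩; exact h n⟩
  have h1 : sSup (Set.range fun n : ℕ => n • x) ≤ sSup (Set.range fun n : ℕ => n • x) - x := by
    refine hl.2 ?_
    rintro _ ⟨n, rfl⟩
    rw [le_sub_iff_add_le, ← succ_nsmul]
    exact hl.1 ⟨n + 1, rfl⟩
  simpa using h1

theorem principalPart_add {g x y : E} (hg : 0 ≤ g) (hx : 0 ≤ x) (hy : 0 ≤ y) :
    principalPart g (x + y) = principalPart g x + principalPart g y := by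
  refine le_antisymm ((isLUB_principalPart g _).2 ?_) ?_
  · rintro _ ⟨n, rfl⟩
    refine le_trans ?_ (add_le_add ((isLUB_principalPart g x).1 ⟨n, rfl⟩)
      ((isLUB_principalPart g y).1 ⟨n, rfl⟩))
    simp only [inf_comm _ (n • g)]
    exact inf_add_le_inf_add_inf (nsmul_nonneg hg n) hx hy
  · rw [← le_sub_iff_add_le]
    refine (isLUB_principalPart g x).2 ?_
    rintro _ ⟨n, rfl⟩
    rw [le_sub_comm]
    refine (isLUB_principalPart g y).2 ?_
    rintro _ ⟨m, rfl⟩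
    rw [le_sub_iff_add_le']
    refine le_trans (le_inf ?_ ?_) ((isLUB_principalPart g (x + y)).1 ⟨n + m, rfl⟩)
    · exact add_le_add inf_le_left inf_le_left
    · rw [add_nsmul]
      exact add_le_add inf_le_right inf_le_right

/-- Independence of the way an element is written as a difference of positive ones; this makes the
extension from the positive cone linear. -/
theorem principalPart_sub_eq {g a b c d : E} (hg : 0 ≤ g) (ha : 0 ≤ a) (hb : 0 ≤ b)
    (hc : 0 ≤ c) (hd : 0 ≤ d) (h : a - b = c - d) :
    principalPart g a - principalPart g b = principalPart g c - principalPart g d := by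
  rw [sub_eq_sub_iff_add_eq_add] at h ⊢
  rw [← principalPart_add hg ha hd, h, principalPart_add hg hc hb]

variable [Module ℝ E] [IsOrderedModule ℝ E]

theorem principalPart_smul_le {g x : E} (hg : 0 ≤ g) {r : ℝ} (hr : 0 < r) :
    principalPart g (r • x) ≤ r • principalPart g x := by
  refine (isLUB_principalPart g _).2 ?_
  rintro _ ⟨n, rfl⟩
  obtain ⟨m, hm⟩ := exists_nat_ge (r⁻¹ * n)
  have h1 : r⁻¹ • (r • x ⊓ n • g) ≤ x ⊓ m • g := by
    refine le_inf ?_ ?_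
    · refine (smul_le_smul_of_nonneg_left inf_le_left (inv_nonneg.2 hr.le)).trans_eq ?_
      rw [smul_smul, inv_mul_cancel₀ hr.ne', one_smul]
    · refine (smul_le_smul_of_nonneg_left inf_le_right (inv_nonneg.2 hr.le)).trans ?_
      rw [← Nat.cast_smul_eq_nsmul ℝ n, ← Nat.cast_smul_eq_nsmul ℝ m, smul_smul]
      exact smul_le_smul_of_nonneg_right hm hg
  have h2 := smul_le_smul_of_nonneg_left
    (h1.trans ((isLUB_principalPart g x).1 ⟨m, rfl⟩)) hr.le
  rwa [smul_smul, mul_inv_cancel₀ hr.ne', one_smul] at h2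

theorem principalPart_smul {g x : E} (hg : 0 ≤ g) {r : ℝ} (hr : 0 < r) :
    principalPart g (r • x) = r • principalPart g x := by
  refine le_antisymm (principalPart_smul_le hg hr) ?_
  have h1 := principalPart_smul_le (x := r • x) hg (inv_pos.2 hr)
  rw [smul_smul, inv_mul_cancel₀ hr.ne', one_smul] at h1
  have h2 := smul_le_smul_of_nonneg_left h1 hr.le
  rwa [smul_smul, mul_inv_cancel₀ hr.ne', one_smul] at h2

/-- The band projection onto the band generated by `g ≥ 0`. -/
noncomputable def principalProjection (g : E) (hg : 0 ≤ g) : E →ₗ[ℝ] E where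
  toFun x := principalPart g x⁺ - principalPart g x⁻
  map_add' x y := by
    rw [sub_add_sub_comm, ← principalPart_add hg (posPart_nonneg _) (posPart_nonneg _),
      ← principalPart_add hg (negPart_nonneg _) (negPart_nonneg _)]
    refine principalPart_sub_eq hg (posPart_nonneg _) (negPart_nonneg _)
      (add_nonneg (posPart_nonneg _) (posPart_nonneg _))
      (add_nonneg (negPart_nonneg _) (negPart_nonneg _)) ?_
    rw [add_sub_add_comm, posPart_sub_negPart, posPart_sub_negPart, posPart_sub_negPart]
  map_smul' r x := by
    simp only [RingHom.id_apply]
    rcases lt_trichotomy r 0 with hr | rfl | hr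
    · have hr' : 0 < -r := neg_pos.2 hr
      rw [← neg_neg (r • (principalPart g x⁺ - principalPart g x⁻)), ← neg_smul, smul_sub,
        ← principalPart_smul hg hr', ← principalPart_smul hg hr', neg_sub]
      refine principalPart_sub_eq hg (posPart_nonneg _) (negPart_nonneg _)
        (smul_nonneg hr'.le (negPart_nonneg _)) (smul_nonneg hr'.le (posPart_nonneg _)) ?_
      rw [posPart_sub_negPart, ← smul_sub, ← neg_sub x⁺, posPart_sub_negPart, smul_neg, neg_smul,
        neg_neg]
    · simp [posPart_def, negPart_def, principalPart_zero g]
    · rw [smul_sub, ← principalPart_smul hg hr, ← principalPart_smul hg hr]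
      refine principalPart_sub_eq hg (posPart_nonneg _) (negPart_nonneg _)
        (smul_nonneg hr.le (posPart_nonneg _)) (smul_nonneg hr.le (negPart_nonneg _)) ?_
      rw [posPart_sub_negPart, ← smul_sub, posPart_sub_negPart]

theorem principalProjection_of_nonneg {g x : E} (hg : 0 ≤ g) (hx : 0 ≤ x) :
    principalProjection g hg x = principalPart g x := by
  simp only [principalProjection, LinearMap.coe_mk, AddHom.coe_mk]
  rw [posPart_eq_self.2 hx, negPart_eq_zero.2 hx, principalPart_zero g, sub_zero]

theorem isBandProjection_principalProjection {g : E} (hg : 0 ≤ g) :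
    IsBandProjection (principalProjection g hg) := by
  have hle : ∀ x : E, principalPart g x ≤ x := fun x =>
    (isLUB_principalPart g x).2 (by rintro _ ⟨n, rfl⟩; exact inf_le_left)
  have hid : ∀ x : E, 0 ≤ x → principalPart g (principalPart g x) = principalPart g x := by
    refine fun x hx => le_antisymm (hle _) ((isLUB_principalPart g x).2 ?_)
    rintro _ ⟨n, rfl⟩
    exact (le_inf ((isLUB_principalPart g x).1 ⟨n, rfl⟩) inf_le_right).trans
      ((isLUB_principalPart g _).1 ⟨n, rfl⟩)
  refine ⟨fun x => ?_, fun x hx => ?_, fun x hx => ?_⟩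
  · rw [← posPart_sub_negPart x]
    simp only [map_sub]
    rw [principalProjection_of_nonneg hg (posPart_nonneg x),
      principalProjection_of_nonneg hg (negPart_nonneg x),
      principalProjection_of_nonneg hg (principalPart_nonneg (posPart_nonneg x)),
      principalProjection_of_nonneg hg (principalPart_nonneg (negPart_nonneg x)),
      hid _ (posPart_nonneg x), hid _ (negPart_nonneg x)]
  · rw [principalProjection_of_nonneg hg hx]
    exact principalPart_nonneg hx
  · rw [principalProjection_of_nonneg hg hx]
    exact hle x

/-- The band projection onto the band generated by `h⁺` maps `h` to `h⁺`. -/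
theorem principalProjection_posPart (h : E) :
    principalProjection h⁺ (posPart_nonneg h) h = h⁺ := by
  nth_rewrite 3 [← posPart_sub_negPart h]
  rw [map_sub, principalProjection_of_nonneg _ (posPart_nonneg h),
    principalProjection_of_nonneg _ (negPart_nonneg h)]
  have h1 : principalPart h⁺ h⁺ = h⁺ :=
    le_antisymm ((isLUB_principalPart _ _).2 (by rintro _ ⟨n, rfl⟩; exact inf_le_left))
      ((isLUB_principalPart h⁺ h⁺).1 ⟨1, by simp⟩)
  have h2 : principalPart h⁺ h⁻ = 0 := by
    refine le_antisymm ((isLUB_principalPart _ _).2 ?_) (principalPart_nonneg (negPart_nonneg h))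
    rintro _ ⟨n, rfl⟩
    refine (inf_nsmul_eq_zero (negPart_nonneg h) (posPart_nonneg h) ?_ n).le
    rw [inf_comm]
    exact posPart_inf_negPart_eq_zero h
  rw [h1, h2, sub_zero]

end Principal

/-! ### Ranges of conditional expectations and localization -/

section ConditionalExpectation

variable {E : Type u} [AddCommGroup E] [ConditionallyCompleteLattice E] [Module ℝ E]

namespace IsConditionalExpectation

variable {W : E →ₗ[ℝ] E}

theorem apply_of_mem (hW : IsConditionalExpectation W) {x : E} (hx : x ∈ LinearMap.range W) :
    W x = x := by
  obtain ⟨y, rfl⟩ := hx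
  exact hW.idem y

theorem range_posPart (hW : IsConditionalExpectation W) {x : E} (hx : x ∈ LinearMap.range W) :
    x⁺ ∈ LinearMap.range W :=
  hW.range_sup _ hx _ (zero_mem _)

theorem range_abs (hW : IsConditionalExpectation W) {x : E} (hx : x ∈ LinearMap.range W) :
    |x| ∈ LinearMap.range W :=
  hW.range_sup _ hx _ (neg_mem hx)

end IsConditionalExpectation

variable [IsOrderedAddMonoid E]

theorem id_sub_mem_bandProjections {e : E} {W P : E →ₗ[ℝ] E} (hWe : W e = e)
    (hP : P ∈ bandProjections e W) : LinearMap.id - P ∈ bandProjections e W :=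
  ⟨hP.1.compl, by
    simpa using (LinearMap.range W).sub_mem ⟨e, hWe⟩ hP.2⟩

namespace IsConditionalExpectation

variable {W : E →ₗ[ℝ] E}

theorem mono (hW : IsConditionalExpectation W) {x y : E} (h : x ≤ y) : W x ≤ W y := by
  have := hW.nonneg (y - x) (sub_nonneg.2 h)
  rwa [map_sub, sub_nonneg] at this

theorem abs_apply_le (hW : IsConditionalExpectation W) (x : E) : |W x| ≤ W |x| :=
  abs_le'.2 ⟨hW.mono (le_abs_self x), by rw [← map_neg]; exact hW.mono (neg_le_abs x)⟩

theorem range_inf (hW : IsConditionalExpectation W) {x y : E} (hx : x ∈ LinearMap.range W)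
    (hy : y ∈ LinearMap.range W) : x ⊓ y ∈ LinearMap.range W := by
  have h : x ⊓ y = -(-x ⊔ -y) := by rw [neg_sup, neg_neg, neg_neg]
  rw [h]
  exact neg_mem (hW.range_sup _ (neg_mem hx) _ (neg_mem hy))

/-- The range of a conditional expectation is closed under suprema of directed sets. -/
theorem range_isLUB_of_directedOn (hW : IsConditionalExpectation W) {S : Set E}
    (hne : S.Nonempty) (hdir : DirectedOn (· ≤ ·) S) (hS : S ⊆ LinearMap.range W) {a : E}
    (ha : IsLUB S a) : a ∈ LinearMap.range W := by
  -- `a - S` decreases to `0` and `W (a - s) = W a - s`, so the lower bound `W a - a` of its image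
  -- is at most `0`.
  have h := hW.order_continuous ((fun s => a - s) '' S) (hne.image _) ?_ ?_
  · refine ⟨a, le_antisymm ?_ (ha.2 fun s hs => ?_)⟩
    · have h1 : W a - a ≤ 0 := by
        refine h.2 ?_
        rintro _ ⟨_, ⟨s, hs, rfl⟩, rfl⟩
        rw [map_sub, hW.apply_of_mem (hS hs)]
        exact sub_le_sub_left (ha.1 hs) _
      exact sub_nonpos.1 h1
    · rw [← hW.apply_of_mem (hS hs)]
      exact hW.mono (ha.1 hs)
  · rintro _ ⟨s, hs, rfl⟩ _ ⟨t, ht, rfl⟩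
    obtain ⟨r, hr, hsr, htr⟩ := hdir s hs t ht
    exact ⟨a - r, ⟨r, hr, rfl⟩, sub_le_sub_left hsr a, sub_le_sub_left htr a⟩
  · refine ⟨?_, fun b hb => ?_⟩
    · rintro _ ⟨s, hs, rfl⟩
      exact sub_nonneg.2 (ha.1 hs)
    · have h1 : a ≤ a - b := ha.2 fun s hs => by
        rw [le_sub_comm]
        exact hb ⟨s, hs, rfl⟩
      simpa using h1

/-- The range of a conditional expectation is closed under suprema. -/
theorem range_isLUB (hW : IsConditionalExpectation W) {S : Set E} (hne : S.Nonempty)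
    (hS : S ⊆ LinearMap.range W) {a : E} (ha : IsLUB S a) : a ∈ LinearMap.range W := by
  -- Closing `S` under finite suprema makes it directed, keeps it in the range and does not change
  -- its upper bounds.
  refine hW.range_isLUB_of_directedOn (S := supClosure S) (hne.mono subset_supClosure) ?_ ?_
    (a := a) ?_
  · exact supClosed_supClosure.directedOn
  · exact supClosure_min hS fun x hx y hy => hW.range_sup x hx y hy
  · rwa [IsLUB, upperBounds_supClosure]

theorem range_principalPart (hW : IsConditionalExpectation W) {g x : E}
    (hg : g ∈ LinearMap.range W) (hx : x ∈ LinearMap.range W) :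
    principalPart g x ∈ LinearMap.range W := by
  refine hW.range_isLUB (Set.range_nonempty _) ?_ (isLUB_principalPart g x)
  rintro _ ⟨n, rfl⟩
  exact hW.range_inf hx (nsmul_mem hg n)

/-- `W` commutes with the band projections `P` such that `P e ∈ R(W)`. -/
theorem comm_apply (hW : IsConditionalExpectation W) {e : E} (hWe : W e = e)
    {P : E →ₗ[ℝ] E} (hP : P ∈ bandProjections e W) {x : E} (hx0 : 0 ≤ x) (hxe : x ≤ e) :
    W (P x) = P (W x) := by
  -- `0 ≤ W P x ≤ W P e = P e`, and `I - P` kills `P e`. Applying this to `I - P` as well gives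
  -- commutation.
  have key : ∀ P : E →ₗ[ℝ] E, P ∈ bandProjections e W → W (P x) = P (W (P x)) := by
    intro P hP
    have h1 : (LinearMap.id - P : E →ₗ[ℝ] E) (W (P x)) ≤
        (LinearMap.id - P : E →ₗ[ℝ] E) (W (P e)) :=
      hP.1.compl.mono (hW.mono (hP.1.mono hxe))
    have h2 := hP.1.compl.nonneg _ (hW.nonneg _ (hP.1.nonneg x hx0))
    rw [hW.apply_of_mem hP.2] at h1
    simp only [LinearMap.sub_apply, LinearMap.id_apply, hP.1.idem, sub_self] at h1 h2
    exact sub_eq_zero.1 (le_antisymm h1 h2)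
  have h1 := key P hP
  have h2 := key _ (id_sub_mem_bandProjections hWe hP)
  simp only [LinearMap.sub_apply, LinearMap.id_apply, map_sub] at h2
  rw [← sub_eq_zero] at h2
  have h3 : P (W x) - P (W (P x)) = 0 := by
    rw [← h2]
    abel
  rw [sub_eq_zero.1 h3, ← h1]

theorem comp_mem_bandProjections (hW : IsConditionalExpectation W) {e : E} (he : 0 ≤ e)
    (hWe : W e = e) {P Q : E →ₗ[ℝ] E} (hP : P ∈ bandProjections e W)
    (hQ : Q ∈ bandProjections e W) : P ∘ₗ Q ∈ bandProjections e W := by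
  refine ⟨hP.1.comp hQ.1, P (Q e), ?_⟩
  rw [hW.comm_apply hWe hP (hQ.1.nonneg e he) (hQ.1.le_self e he), hW.apply_of_mem hQ.2]
  rfl

variable [IsOrderedModule ℝ E]

theorem principalProjection_mem_bandProjections (hW : IsConditionalExpectation W) {e g : E}
    (he : 0 ≤ e) (hWe : W e = e) (hg0 : 0 ≤ g) (hg : g ∈ LinearMap.range W) :
    principalProjection g hg0 ∈ bandProjections e W :=
  ⟨isBandProjection_principalProjection hg0, by
    rw [principalProjection_of_nonneg hg0 he]
    exact hW.range_principalPart hg ⟨e, hWe⟩⟩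

/-- An inequality `y ≤ 0` may be checked on band projections that are small enough for
`f ∈ R(W)`, `0 ≤ f ≤ e`, to be almost constant on them. -/
theorem nonpos_of_locally_nonpos (hW : IsConditionalExpectation W) {e f y : E} (he : 0 ≤ e)
    (hWe : W e = e) (hf : f ∈ LinearMap.range W) (hf0 : 0 ≤ f) (hfe : f ≤ e) {n : ℕ} (hn : 0 < n)
    (h : ∀ R ∈ bandProjections e W, ∀ c : ℝ, 0 ≤ c → c ≤ 1 →
      c • R e ≤ R f → R f ≤ (c + 1 / n) • R e → R y ≤ 0) : y ≤ 0 := by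
  have hn' : (0 : ℝ) < n := by exact_mod_cast hn
  -- `F k` projects onto the band where `f` exceeds `(k / n) e`.
  let h' : ℕ → E := fun k => f - ((k : ℝ) / n) • e
  let F : ℕ → E →ₗ[ℝ] E := fun k => principalProjection (h' k)⁺ (posPart_nonneg _)
  have hF : ∀ k, F k ∈ bandProjections e W := fun k =>
    hW.principalProjection_mem_bandProjections he hWe _
      (hW.range_posPart (sub_mem hf ((LinearMap.range W).smul_mem _ ⟨e, hWe⟩)))
  have hFh : ∀ k, F k (h' k) = (h' k)⁺ := fun k => principalProjection_posPart _
  have hGh : ∀ k, (LinearMap.id - F k : E →ₗ[ℝ] E) (h' k) ≤ 0 := fun k => by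
    rw [LinearMap.sub_apply, hFh, LinearMap.id_apply, sub_nonpos]
    exact le_posPart _
  -- Level by level: `I - F (k+1)` splits into `(I - F (k+1)) F k`, where `f` lies between `k / n`
  -- and `(k + 1) / n`, and a part of `I - F k`, covered by induction. At `k = n` the complement is
  -- everything, as `f ≤ e`.
  have main : ∀ k, k ≤ n → (LinearMap.id - F k : E →ₗ[ℝ] E) y ≤ 0 := by
    intro k
    induction k with
    | zero =>
      intro _
      refine h _ (id_sub_mem_bandProjections hWe (hF 0)) 0 le_rfl zero_le_one ?_ ?_
      · rw [zero_smul]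
        exact (hF 0).1.compl.nonneg f hf0
      · have h1 := hGh 0
        simp only [h', Nat.cast_zero, zero_div, zero_smul, sub_zero] at h1
        exact h1.trans (smul_nonneg (by positivity) ((hF 0).1.compl.nonneg e he))
    | succ k ih =>
      intro hk
      have ih := ih (by omega)
      have hG := id_sub_mem_bandProjections hWe (hF (k + 1))
      have h1 := h _ (hW.comp_mem_bandProjections he hWe hG (hF k)) (k / n) (by positivity)
        (by
          rw [div_le_one hn']
          exact_mod_cast (by omega : k ≤ n)) ?_ ?_
      · have h2 := (hG.1.mono ih)
        rw [map_zero] at h2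
        have h3 := add_nonpos h1 h2
        refine le_of_eq_of_le ?_ h3
        simp only [LinearMap.comp_apply, ← map_add]
        congr 1
        simp
      · rw [← sub_nonneg, ← map_smul, ← map_sub]
        rw [LinearMap.comp_apply]
        change 0 ≤ (LinearMap.id - F (k + 1) : E →ₗ[ℝ] E) (F k (h' k))
        rw [hFh]
        exact hG.1.nonneg _ (posPart_nonneg _)
      · rw [← sub_nonpos, ← map_smul, ← map_sub, LinearMap.comp_apply, hG.1.comm (hF k).1]
        have h2 := (hF k).1.mono (hGh (k + 1))
        rw [map_zero] at h2
        refine le_of_eq_of_le ?_ h2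
        simp only [h']
        congr 4
        push_cast
        ring
  have h1 := main n le_rfl
  have h2 : F n y = 0 := by
    have h3 : (h' n)⁺ = 0 := by
      rw [posPart_eq_zero]
      simp only [h', div_self hn'.ne', one_smul]
      exact sub_nonpos.2 hfe
    have h4 : ∀ x : E, 0 ≤ x → F n x = 0 := by
      intro x hx
      simp only [F]
      rw [principalProjection_of_nonneg _ hx]
      refine le_antisymm ((isLUB_principalPart _ _).2 ?_) (principalPart_nonneg hx)
      rintro _ ⟨m, rfl⟩
      rw [h3]
      simp
    rw [← posPart_sub_negPart y, map_sub, h4 _ (posPart_nonneg y), h4 _ (negPart_nonneg y),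
      sub_zero]
  simpa [h2] using h1

end IsConditionalExpectation

end ConditionalExpectation

/-! ### The product of `e`-bounded elements and the averaging property -/

section Product

variable {E : Type u} [AddCommGroup E] [ConditionallyCompleteLattice E] [IsOrderedAddMonoid E]
  [Module ℝ E] [IsOrderedModule ℝ E]

/-- A form of `2ts - t² ≤ s²` with `s = |c| + δ` for `t ≥ 0` and `s = -(|c| + δ)` for `t ≤ 0`; the
sign of `t` decides which bound on `g` is used. -/
theorem two_mul_smul_sub_le {g w : E} (hw : 0 ≤ w) {c δ : ℝ} (h1 : (c - δ) • w ≤ g)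
    (h2 : g ≤ (c + δ) • w) (t : ℝ) : (2 * t) • g - t ^ 2 • w ≤ ((|c| + δ) ^ 2) • w := by
  rcases le_total 0 t with ht | ht
  · have h3 := smul_le_smul_of_nonneg_left h2 (by linarith : 0 ≤ 2 * t)
    have h4 : (2 * t * (c + δ) - t ^ 2) • w ≤ ((|c| + δ) ^ 2) • w := by
      refine smul_le_smul_of_nonneg_right ?_ hw
      nlinarith [le_abs_self c, sq_nonneg (|c| + δ - t), mul_le_mul_of_nonneg_left (le_abs_self c) ht]
    rw [smul_smul] at h3
    rw [sub_smul] at h4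
    exact (sub_le_sub_right h3 _).trans h4
  · have h3 := smul_le_smul_of_nonneg_left h1 (by linarith : 0 ≤ -(2 * t))
    have h4 : (2 * t * (c - δ) - t ^ 2) • w ≤ ((|c| + δ) ^ 2) • w := by
      refine smul_le_smul_of_nonneg_right ?_ hw
      nlinarith [neg_abs_le c, sq_nonneg (|c| + δ + t),
        mul_le_mul_of_nonneg_left (neg_abs_le c) (neg_nonneg.2 ht)]
    rw [smul_smul, neg_mul, neg_smul, neg_smul, neg_le_neg_iff] at h3
    rw [sub_smul] at h4
    exact (sub_le_sub_right h3 _).trans h4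

theorem isLUB_eSquare {e f : E} (he : 0 ≤ e) {k : ℝ} (h1 : (-k) • e ≤ f) (h2 : f ≤ k • e) :
    IsLUB (Set.range fun t : ℝ => (2 * t) • f - (t ^ 2) • e) (eSquare e f) := by
  refine isLUB_csSup (Set.range_nonempty _) ⟨((|0| + k) ^ 2) • e, ?_⟩
  rintro _ ⟨t, rfl⟩
  exact two_mul_smul_sub_le he (by rwa [zero_sub]) (by rwa [zero_add]) t

theorem apply_eSquare_le {e f : E} (he : 0 ≤ e) {k : ℝ} (hk1 : (-k) • e ≤ f) (hk2 : f ≤ k • e)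
    {R : E →ₗ[ℝ] E} (hR : IsBandProjection R) {c δ : ℝ} (h1 : (c - δ) • R e ≤ R f)
    (h2 : R f ≤ (c + δ) • R e) : R (eSquare e f) ≤ ((|c| + δ) ^ 2) • R e := by
  refine (hR.isLUB_image (isLUB_eSquare he hk1 hk2)).2 ?_
  rintro _ ⟨_, ⟨t, rfl⟩, rfl⟩
  simp only [map_sub, map_smul]
  exact two_mul_smul_sub_le (hR.nonneg e he) h1 h2 t

theorem le_apply_eSquare {e f : E} (he : 0 ≤ e) {k : ℝ} (hk1 : (-k) • e ≤ f) (hk2 : f ≤ k • e)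
    {R : E →ₗ[ℝ] E} (hR : IsBandProjection R) {c δ : ℝ} (h1 : (c - δ) • R e ≤ R f)
    (h2 : R f ≤ (c + δ) • R e) : (c ^ 2 - 2 * |c| * δ) • R e ≤ R (eSquare e f) := by
  -- The term `t = c` of the supremum already suffices.
  refine le_trans ?_ ((hR.isLUB_image (isLUB_eSquare he hk1 hk2)).1 ⟨_, ⟨c, rfl⟩, rfl⟩)
  simp only [map_sub, map_smul]
  rcases le_total 0 c with hc | hc
  · have h3 := smul_le_smul_of_nonneg_left h1 (by linarith : 0 ≤ 2 * c)
    refine le_trans (le_of_eq ?_) (sub_le_sub_right h3 _)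
    rw [abs_of_nonneg hc]
    module
  · have h3 := smul_le_smul_of_nonneg_left h2 (by linarith : 0 ≤ -(2 * c))
    rw [neg_smul, neg_smul, neg_le_neg_iff] at h3
    refine le_trans (le_of_eq ?_) (sub_le_sub_right h3 _)
    rw [abs_of_nonpos hc]
    module

/-- On a band where `a` and `f` are nearly the constants `d` and `c`, the product of `a` and `f`
is nearly the constant `d * c`. -/
theorem apply_eMul_bounds {e a f : E} (he : 0 ≤ e) (ha0 : 0 ≤ a) (hae : a ≤ e) (hf0 : 0 ≤ f)
    (hfe : f ≤ e) {R : E →ₗ[ℝ] E} (hR : IsBandProjection R) {c d ε : ℝ} (hc0 : 0 ≤ c)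
    (hc1 : c ≤ 1) (hd0 : 0 ≤ d) (hd1 : d ≤ 1) (hε0 : 0 ≤ ε) (hε1 : ε ≤ 1)
    (hf1 : c • R e ≤ R f) (hf2 : R f ≤ (c + ε) • R e)
    (ha1 : d • R e ≤ R a) (ha2 : R a ≤ (d + ε) • R e) :
    (d * c - 5 * ε) • R e ≤ R (eMul e a f) ∧ R (eMul e a f) ≤ (d * c + 5 * ε) • R e := by
  have hRe := hR.nonneg e he
  have e2 : (2 : ℝ) • e = e + e := two_smul ℝ e
  have s1 : (-2 : ℝ) • e ≤ a + f := by
    rw [neg_smul, e2]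
    exact (neg_nonpos.2 (add_nonneg he he)).trans (add_nonneg ha0 hf0)
  have s2 : a + f ≤ (2 : ℝ) • e := by
    rw [e2]
    exact add_le_add hae hfe
  have s3 : (-2 : ℝ) • e ≤ a - f := by
    rw [neg_smul, e2, neg_add, ← sub_eq_add_neg]
    exact sub_le_sub ((neg_nonpos.2 he).trans ha0) hfe
  have s4 : a - f ≤ (2 : ℝ) • e := by
    rw [e2]
    exact (sub_le_self _ hf0).trans (hae.trans (le_add_of_nonneg_right he))
  have p1 : (d + c - 2 * ε) • R e ≤ R (a + f) := by
    rw [map_add]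
    refine le_trans ?_ (add_le_add ha1 hf1)
    rw [← add_smul]
    exact smul_le_smul_of_nonneg_right (by linarith) hRe
  have p2 : R (a + f) ≤ (d + c + 2 * ε) • R e := by
    rw [map_add]
    refine (add_le_add ha2 hf2).trans ?_
    rw [← add_smul]
    exact smul_le_smul_of_nonneg_right (by linarith) hRe
  have p3 : (d - c - ε) • R e ≤ R (a - f) := by
    rw [map_sub]
    refine le_trans ?_ (sub_le_sub ha1 hf2)
    rw [← sub_smul]
    exact smul_le_smul_of_nonneg_right (by linarith) hRe
  have p4 : R (a - f) ≤ (d - c + ε) • R e := by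
    rw [map_sub]
    refine (sub_le_sub ha2 hf1).trans ?_
    rw [← sub_smul]
    exact smul_le_smul_of_nonneg_right (by linarith) hRe
  have q1 := apply_eSquare_le he s1 s2 hR p1 p2
  have q2 := le_apply_eSquare he s1 s2 hR p1 p2
  have q3 := apply_eSquare_le he s3 s4 hR p3 p4
  have q4 := le_apply_eSquare he s3 s4 hR p3 p4
  have hs : |d + c| = d + c := abs_of_nonneg (by linarith)
  have hdc : |d - c| ≤ 1 := abs_le.2 ⟨by linarith, by linarith⟩
  have hdc0 := abs_nonneg (d - c)
  have hsq := sq_abs (d - c)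
  rw [hs] at q1 q2
  have m1 : R (eMul e a f) = (1 / 4 : ℝ) • (R (eSquare e (a + f)) - R (eSquare e (a - f))) := by
    rw [eMul, map_smul, map_sub]
  have hεε : ε * ε ≤ ε := mul_le_of_le_one_left hε0 hε1
  have t1 : |d - c| * ε ≤ ε := mul_le_of_le_one_left hε0 hdc
  have t2 : 0 ≤ |d - c| * ε := mul_nonneg hdc0 hε0
  have t3 : d * ε ≤ ε := mul_le_of_le_one_left hε0 hd1
  have t4 : c * ε ≤ ε := mul_le_of_le_one_left hε0 hc1
  -- Polarization with errors `2ε` for `a + f` and `ε` for `a - f` costs at most `7ε/2`; the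
  -- constant `5` leaves slack.
  rw [m1]
  constructor
  · refine le_trans ?_ (smul_le_smul_of_nonneg_left (sub_le_sub q2 q3) (by norm_num))
    rw [← sub_smul, smul_smul]
    refine smul_le_smul_of_nonneg_right ?_ hRe
    nlinarith
  · refine (smul_le_smul_of_nonneg_left (sub_le_sub q1 q4) (by norm_num)).trans ?_
    rw [← sub_smul, smul_smul]
    refine smul_le_smul_of_nonneg_right ?_ hRe
    nlinarith

theorem nonpos_of_forall_smul_le {x e : E} (he : 0 ≤ e) (C : ℝ)
    (h : ∀ n : ℕ, 0 < n → x ≤ (C * (1 / n)) • e) : x ≤ 0 := by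
  -- `|C|` rather than `C`, so that the bound also holds for `n = 0`.
  refine nonpos_of_nsmul_le (b := |C| • e) fun n => ?_
  rcases Nat.eq_zero_or_pos n with rfl | hn
  · simpa using smul_nonneg (abs_nonneg C) he
  · have hn' : (0 : ℝ) < n := by exact_mod_cast hn
    rw [← Nat.cast_smul_eq_nsmul ℝ n]
    refine (smul_le_smul_of_nonneg_left (h n hn) hn'.le).trans ?_
    rw [smul_smul]
    refine smul_le_smul_of_nonneg_right ?_ he
    have : n * (C * (1 / n)) = C := by field_simp
    rw [this]
    exact le_abs_self C

/-- The averaging property: `T (P f) = T (P e) · f` for `f ∈ R(T)`. -/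
theorem IsConditionalExpectation.apply_bandProjection_eq_eMul {T : E →ₗ[ℝ] E}
    (hT : IsConditionalExpectation T) {e f : E} (he : 0 ≤ e) (hTe : T e = e) {P : E →ₗ[ℝ] E}
    (hP : IsBandProjection P) (hf : f ∈ LinearMap.range T) (hf0 : 0 ≤ f) (hfe : f ≤ e) :
    T (P f) = eMul e (T (P e)) f := by
  have ha0 : 0 ≤ T (P e) := hT.nonneg _ (hP.nonneg e he)
  have hae : T (P e) ≤ e := (hT.mono (hP.le_self e he)).trans_eq hTe
  have hPf0 := hP.nonneg f hf0
  have hPfe : P f ≤ e := (hP.le_self f hf0).trans hfe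
  -- `R` commutes with `T` and `P`, so `R T P f` lies between `cd` and `(c + ε)(d + ε) ≤ cd + 3ε`
  -- times `R e`. With the `5ε` of the product this gives `8`.
  have main : ∀ n : ℕ, 0 < n → ∀ R ∈ bandProjections e T,
      ∀ c : ℝ, 0 ≤ c → c ≤ 1 → c • R e ≤ R f → R f ≤ (c + 1 / n) • R e →
      ∀ d : ℝ, 0 ≤ d → d ≤ 1 → d • R e ≤ R (T (P e)) → R (T (P e)) ≤ (d + 1 / n) • R e →
      R (T (P f) - eMul e (T (P e)) f) ≤ (8 * (1 / n : ℝ)) • R e ∧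
      R (eMul e (T (P e)) f - T (P f)) ≤ (8 * (1 / n : ℝ)) • R e := by
    intro n hn R hR c hc0 hc1 hf1 hf2 d hd0 hd1 ha1 ha2
    have hn' : (1 : ℝ) ≤ n := by exact_mod_cast hn
    have hε0 : (0 : ℝ) ≤ 1 / n := by positivity
    have hε1 : (1 : ℝ) / n ≤ 1 := by
      rw [div_le_one (by linarith)]
      exact hn'
    generalize (1 : ℝ) / n = ε at *
    have hRe := hR.1.nonneg e he
    obtain ⟨m1, m2⟩ := apply_eMul_bounds he ha0 hae hf0 hfe hR.1 hc0 hc1 hd0 hd1 hε0 hε1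
      hf1 hf2 ha1 ha2
    have r1 : R (T (P f)) = T (P (R f)) := by
      rw [← hT.comm_apply hTe hR hPf0 hPfe, hP.comm hR.1]
    have r2 : R (T (P e)) = T (P (R e)) := by
      rw [← hT.comm_apply hTe hR (hP.nonneg e he) (hP.le_self e he), hP.comm hR.1]
    have l1 := hT.mono (hP.mono hf1)
    have l2 := hT.mono (hP.mono hf2)
    rw [map_smul, map_smul, ← r1, ← r2] at l1 l2
    have l3 := (smul_le_smul_of_nonneg_left ha1 hc0).trans l1
    have l4 := l2.trans (smul_le_smul_of_nonneg_left ha2 (add_nonneg hc0 hε0))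
    rw [smul_smul] at l3 l4
    have hεε : ε * ε ≤ ε := mul_le_of_le_one_left hε0 hε1
    have t3 : d * ε ≤ ε := mul_le_of_le_one_left hε0 hd1
    have t4 : c * ε ≤ ε := mul_le_of_le_one_left hε0 hc1
    constructor
    · rw [map_sub]
      refine (sub_le_sub l4 m1).trans ?_
      rw [← sub_smul]
      exact smul_le_smul_of_nonneg_right (by nlinarith) hRe
    · rw [map_sub]
      refine (sub_le_sub m2 l3).trans ?_
      rw [← sub_smul]
      exact smul_le_smul_of_nonneg_right (by nlinarith) hRe
  -- Localize `y - (8 / n) e` twice, first along `f` and then along `T (P e)`; the bands that result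
  -- have projections `R ∘ S`.
  have glue : ∀ y : E, (∀ n : ℕ, 0 < n → ∀ R ∈ bandProjections e T,
      ∀ c : ℝ, 0 ≤ c → c ≤ 1 → c • R e ≤ R f → R f ≤ (c + 1 / n) • R e →
      ∀ d : ℝ, 0 ≤ d → d ≤ 1 → d • R e ≤ R (T (P e)) → R (T (P e)) ≤ (d + 1 / n) • R e →
      R y ≤ (8 * (1 / n : ℝ)) • R e) → y ≤ 0 := by
    intro y hy
    refine nonpos_of_forall_smul_le he 8 fun n hn => sub_nonpos.1 ?_
    refine hT.nonpos_of_locally_nonpos he hTe hf hf0 hfe hn fun R hR c hc0 hc1 hf1 hf2 => ?_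
    refine hT.nonpos_of_locally_nonpos he hTe ⟨P e, rfl⟩ ha0 hae hn
      fun S hS d hd0 hd1 ha1 ha2 => ?_
    have := hy n hn _ (hT.comp_mem_bandProjections he hTe hR hS) c hc0 hc1 ?_ ?_ d hd0 hd1 ?_ ?_
    · rw [hS.1.comm hR.1, map_sub, map_sub, map_smul, map_smul, sub_nonpos]
      exact this
    · simp only [LinearMap.comp_apply, hR.1.comm hS.1]
      rw [← map_smul]
      exact hS.1.mono hf1
    · simp only [LinearMap.comp_apply, hR.1.comm hS.1]
      rw [← map_smul]
      exact hS.1.mono hf2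
    · simp only [LinearMap.comp_apply]
      rw [← map_smul]
      exact hR.1.mono ha1
    · simp only [LinearMap.comp_apply]
      rw [← map_smul]
      exact hR.1.mono ha2
  refine le_antisymm (sub_nonpos.1 (glue _ ?_)) (sub_nonpos.1 (glue _ ?_))
  · intro n hn R hR c hc0 hc1 hf1 hf2 d hd0 hd1 ha1 ha2
    exact (main n hn R hR c hc0 hc1 hf1 hf2 d hd0 hd1 ha1 ha2).1
  · intro n hn R hR c hc0 hc1 hf1 hf2 d hd0 hd1 ha1 ha2
    exact (main n hn R hR c hc0 hc1 hf1 hf2 d hd0 hd1 ha1 ha2).2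

end Product

/-! ### Comparison of the two families -/

section StrongMixing

variable {E : Type u} [AddCommGroup E] [ConditionallyCompleteLattice E] [IsOrderedAddMonoid E]
  [Module ℝ E] {T U : E →ₗ[ℝ] E} {e : E}

theorem tNorm_le (he : 0 ≤ e) (hT : IsConditionalExpectation T) (hTe : T e = e)
    (hU : IsConditionalExpectation U) (hUe : U e = e)
    {Q : E →ₗ[ℝ] E} (hQ : IsBandProjection Q) : tNorm T (U (Q e) - T (Q e)) ≤ e := by
  have hQ0 := hQ.nonneg e he
  have hQe := hQ.le_self e he
  refine (hT.mono (abs_le'.2 ⟨?_, ?_⟩)).trans_eq hTe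
  · exact (sub_le_self _ (hT.nonneg _ hQ0)).trans ((hU.mono hQe).trans_eq hUe)
  · rw [neg_sub]
    exact (sub_le_self _ (hU.nonneg _ hQ0)).trans ((hT.mono hQe).trans_eq hTe)

variable [IsOrderedModule ℝ E]

/-- `TPQe - TPe · TQe = TP(UQe - TQe)` for `P ∈ 𝓑(U)`. -/
theorem sub_eMul_eq (he : 0 ≤ e) (hT : IsConditionalExpectation T) (hTe : T e = e)
    (hU : IsConditionalExpectation U) (hUe : U e = e) (hUT : IsCompatible U T)
    {P Q : E →ₗ[ℝ] E} (hP : P ∈ bandProjections e U) (hQ : IsBandProjection Q) :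
    T (P (Q e)) - eMul e (T (P e)) (T (Q e)) = T (P (U (Q e) - T (Q e))) := by
  have hQ0 := hQ.nonneg e he
  have hQe := hQ.le_self e he
  -- Averaging turns the product into `T P T Q e`; `P U = U P` on `Q e` and `T U = T` absorb `U`.
  rw [← hT.apply_bandProjection_eq_eMul he hTe hP.1 ⟨Q e, rfl⟩ (hT.nonneg _ hQ0)
    ((hT.mono hQe).trans_eq hTe), map_sub, map_sub, ← hU.comm_apply hUe hP hQ0 hQe,
    ← LinearMap.comp_apply T U, hUT.1]

/-- Positivity of `T` and `|P g| ≤ P |g| ≤ |g|`. -/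
theorem abs_sub_eMul_le (he : 0 ≤ e) (hT : IsConditionalExpectation T) (hTe : T e = e)
    (hU : IsConditionalExpectation U) (hUe : U e = e) (hUT : IsCompatible U T)
    {P Q : E →ₗ[ℝ] E} (hP : P ∈ bandProjections e U) (hQ : IsBandProjection Q) :
    |T (P (Q e)) - eMul e (T (P e)) (T (Q e))| ≤ tNorm T (U (Q e) - T (Q e)) := by
  rw [sub_eMul_eq he hT hTe hU hUe hUT hP hQ, tNorm]
  refine (hT.abs_apply_le _).trans (hT.mono ?_)
  have h := hP.1.le_self _ (abs_nonneg (U (Q e) - T (Q e)))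
  refine (abs_le'.2 ⟨hP.1.mono (le_abs_self _), ?_⟩).trans h
  rw [← map_neg]
  exact hP.1.mono (neg_le_abs _)

/-- `T|UQe - TQe|` splits along the bands of the positive and the negative part. -/
theorem exists_tNorm_le_add (he : 0 ≤ e) (hT : IsConditionalExpectation T) (hTe : T e = e)
    (hU : IsConditionalExpectation U) (hUe : U e = e) (hUT : IsCompatible U T)
    {Q : E →ₗ[ℝ] E} (hQ : IsBandProjection Q) :
    ∃ P ∈ bandProjections e U, ∃ P' ∈ bandProjections e U,
      tNorm T (U (Q e) - T (Q e)) ≤ |T (P (Q e)) - eMul e (T (P e)) (T (Q e))| +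
        |T (P' (Q e)) - eMul e (T (P' e)) (T (Q e))| := by
  set g : E := U (Q e) - T (Q e) with hg
  have hgU : g ∈ LinearMap.range U := by
    refine sub_mem ⟨Q e, rfl⟩ ⟨T (Q e), ?_⟩
    rw [← LinearMap.comp_apply, hUT.2]
  -- For the projection `P` onto the band of `g⁺`, `P g = g⁺` and `(I - P) g = -g⁻`.
  have hP := hU.principalProjection_mem_bandProjections he hUe (posPart_nonneg g)
    (hU.range_posPart hgU)
  have hP' := id_sub_mem_bandProjections hUe hP
  refine ⟨_, hP, _, hP', ?_⟩
  rw [sub_eMul_eq he hT hTe hU hUe hUT hP hQ, sub_eMul_eq he hT hTe hU hUe hUT hP' hQ, ← hg,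
    LinearMap.sub_apply, LinearMap.id_apply, principalProjection_posPart, tNorm,
    ← posPart_add_negPart, map_add]
  refine add_le_add (le_abs_self _) ?_
  have h : g - g⁺ = -g⁻ := by
    rw [sub_eq_iff_eq_add, neg_add_eq_sub, posPart_sub_negPart]
  rw [h, map_neg, abs_neg]
  exact le_abs_self _

end StrongMixing

end RieszCE

theorem theorem4p3 {E : Type*} [AddCommGroup E] [ConditionallyCompleteLattice E]
    [IsOrderedAddMonoid E] [Module ℝ E] [IsOrderedModule ℝ E]
    {Eu : Type*} [AddCommGroup Eu] [Lattice Eu] [IsOrderedAddMonoid Eu] [Module ℝ Eu]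
    [IsOrderedModule ℝ Eu] (ι : E →ₗ[ℝ] Eu) (hι : IsUniversalCompletion ι)
    (T U V : E →ₗ[ℝ] E) (e : E) (he : IsWeakOrderUnit e)
    (hT : IsConditionalExpectation T) (hTe : T e = e) (hTE : IsTUniversallyComplete ι T)
    (hU : IsConditionalExpectation U) (hUT : IsCompatible U T)
    (hV : IsConditionalExpectation V) (hVT : IsCompatible V T) :
    -- the suprema exist: both families lie in `R(T)`, and each has a least upper bound, which
    -- lies in `R(T)` (so it is the supremum in `E` as well as in `R(T)`)
    (strongMixingSet e T U V ⊆ LinearMap.range T ∧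
      strongMixing e T U V ∈ LinearMap.range T ∧
      IsLUB (strongMixingSet e T U V) (strongMixing e T U V)) ∧
    (normDistanceSet e T U V ⊆ LinearMap.range T ∧
      sSup (normDistanceSet e T U V) ∈ LinearMap.range T ∧
      IsLUB (normDistanceSet e T U V) (sSup (normDistanceSet e T U V))) ∧
    -- the two inequalities
    strongMixing e T U V ≤ sSup (normDistanceSet e T U V) ∧
    sSup (normDistanceSet e T U V) ≤ (2 : ℝ) • strongMixing e T U V := by
  have he0 : 0 ≤ e := he.1
  have hUe : U e = e := by
    have := LinearMap.congr_fun hUT.2 e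
    rwa [LinearMap.comp_apply, hTe] at this
  have h0 : ∀ W : E →ₗ[ℝ] E, 0 ∈ bandProjections e W := fun W =>
    ⟨⟨fun x => by simp, fun x _ => by simp, fun x hx => by simpa using hx⟩, by simp⟩
  have hSne : (strongMixingSet e T U V).Nonempty := ⟨_, _, h0 U, _, h0 V, rfl⟩
  have hNne : (normDistanceSet e T U V).Nonempty := ⟨_, _, h0 V, rfl⟩
  have hN : IsLUB (normDistanceSet e T U V) (sSup (normDistanceSet e T U V)) := by
    refine isLUB_csSup hNne ⟨e, ?_⟩
    rintro _ ⟨Q, hQ, rfl⟩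
    exact tNorm_le he0 hT hTe hU hUe hQ.1
  -- This gives both the existence of `α_T(U, V)` and the left inequality.
  have hle : ∀ x ∈ strongMixingSet e T U V, x ≤ sSup (normDistanceSet e T U V) := by
    rintro _ ⟨P, hP, Q, hQ, rfl⟩
    exact (abs_sub_eMul_le he0 hT hTe hU hUe hUT hP hQ.1).trans (hN.1 ⟨Q, hQ, rfl⟩)
  have hS : IsLUB (strongMixingSet e T U V) (strongMixing e T U V) := isLUB_csSup hSne ⟨_, hle⟩
  have hSR : strongMixingSet e T U V ⊆ LinearMap.range T := by
    rintro _ ⟨P, hP, Q, hQ, rfl⟩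
    rw [sub_eMul_eq he0 hT hTe hU hUe hUT hP hQ.1]
    exact hT.range_abs ⟨_, rfl⟩
  have hNR : normDistanceSet e T U V ⊆ LinearMap.range T := by
    rintro _ ⟨Q, -, rfl⟩
    exact ⟨_, rfl⟩
  refine ⟨⟨hSR, hT.range_isLUB hSne hSR hS, hS⟩, ⟨hNR, hT.range_isLUB hNne hNR hN, hN⟩,
    hS.2 hle, hN.2 ?_⟩
  rintro _ ⟨Q, hQ, rfl⟩
  obtain ⟨P, hP, P', hP', h⟩ := exists_tNorm_le_add he0 hT hTe hU hUe hUT hQ.1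
  rw [two_smul]
  exact h.trans (add_le_add (hS.1 ⟨P, hP, Q, hQ, rfl⟩) (hS.1 ⟨P', hP', Q, hQ, rfl⟩))
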